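/- Let $\Sigma$ and $\Gamma$ be finite alphabets and let $f\colon\Sigma^*\to\Gamma^*$. If $f$ is computed by a masked unique-hard attention transformer encoder (without position encoding, with packed outputs), then $f$ is computed by a masked average-hard attention transformer encoder with position encoding $i/n$, $(i/n)^2$ and $1/(i+2)$. Here an encoder is a fixed finite list of layers acting on sequences of vectors in $\mathbb{R}^d$. A position-wise layer maps $u_i$ to $u_i+F(u_i)$, where $F$ is a two-layer feed-forward network with ReLU activations. An attention layer maps $u_i$ to $u_i+c_i$, where $c_i$ is computed as follows from linear maps $Q,K,V\colon\mathbb{R}^d\to\mathbb{R}^d$ and a mask, with $M_i$ the set of unmasked positions $j$ maximizing the score $\langle Qu_i,Ku_j\rangle$ among the unmasked positions. * Unique-hard: $c_i$ is $Vu_j$ for the leftmost (or, for another choice function, the rightmost) $j\in M_i$, and $0$ if $M_i=\emptyset$; the mask is one of: none, $j<i$, $j\le i$, $j>i$, $j\ge i$. Several such heads, each with its own $Q,K,V$, mask and choice function, may be summed in one layer. On input $w=a_0\cdots a_{n-1}$ the positions are $0,\dots,n-1$, and the initial vector at position $i$ depends only on the symbol $a_i$. The final vector at each position is mapped by a fixed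 function $\mathbb{R}^d\to\Gamma^{\le k}$, for some fixed $k$, to a string of length at most $k$, and the output is the concatenation of these strings. * Average-hard: $c_i=\frac1{|M_i|}\sum_{j\in M_i}Vu_j$, and $0$ if $M_i=\emptyset$; the mask is one of: none, $j<i$, $j\le i$; there is one head per layer. The positions are $-1,0,\dots,n-1$. For an input $w=a_0\cdots a_{\ell-1}$ with $\ell<n$, padded by $a_\ell=\dots=a_{n-1}=\#$ with a padding symbol $\#\notin\Sigma\cup\Gamma$, designated coordinates of the initial vector at position $i$ hold the one-hot encoding of $a_i$ over $\Sigma\cup\{\#\}$ (the zero vector if $i=-1$) and the three numbers $i/n$, $(i/n)^2$, $1/(i+2)$; all other coordinates are $0$. The encoder computes $f$ if there is a nondecreasing $q\colon\mathbb{N}\to\mathbb{N}$ such that for every $w\in\Sigma^*$ we have $|f(w)|\le q(|w|)$ and, for every $n$ with $n>|w|$ and $n>q(|w|)$, on $w$ padded to length $n$ designated coordinates of the final vectors hold the one-hot encoding over $\Gamma\cup\{\#\}$ of $f(w)$ padded by $\#$ to length $n$ (the zero vector at position $-1$). -/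

import Mathlib

/-! # Hard-attention transformer encoders as transducers

Activation vectors live in `ι → ℝ`, where `ι` is a finite set of coordinates (the width is the
cardinality of `ι`). An activation sequence assigns such a vector to every position of a finite
linearly ordered set `P` of positions. -/

namespace HardAttention

/-! ## Position-wise feed-forward networks and attention scores -/

/-- A two-layer feed-forward network with ReLU activations. -/
structure FFN (ι : Type) where
  hidden : ℕ
  W₁ : Matrix (Fin hidden) ι ℝ
  b₁ : Fin hidden → ℝ
  W₂ : Matrix ι (Fin hidden) ℝ
  b₂ : ι → ℝ

/-- `x ↦ W₂ · ReLU (W₁ x + b₁) + b₂`. -/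
def FFN.eval {ι : Type} [Fintype ι] (F : FFN ι) (x : ι → ℝ) : ι → ℝ :=
  F.W₂.mulVec (fun h => max 0 (F.W₁.mulVec x h + F.b₁ h)) + F.b₂

/-- The query, key and value maps of an attention head. -/
structure Head (ι : Type) where
  Q : (ι → ℝ) →ₗ[ℝ] (ι → ℝ)
  K : (ι → ℝ) →ₗ[ℝ] (ι → ℝ)
  V : (ι → ℝ) →ₗ[ℝ] (ι → ℝ)

/-- The attention score `⟨Q x, K y⟩`. -/
def Head.score {ι : Type} [Fintype ι] (H : Head ι) (x y : ι → ℝ) : ℝ :=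
  dotProduct (H.Q x) (H.K y)

/-- The unmasked positions whose score from position `i` is maximal among the unmasked positions;
`mask i j` says that position `i` may attend to position `j`. -/
noncomputable def Head.maximizers {ι P : Type} [Fintype ι] [Fintype P] (H : Head ι)
    (mask : P → P → Prop) (u : P → ι → ℝ) (i : P) : Finset P :=
  open Classical in
  Finset.univ.filter fun j =>
    mask i j ∧ ∀ j', mask i j' → H.score (u i) (u j') ≤ H.score (u i) (u j)

/-! ## Masked unique-hard attention encoders (no position encoding) -/

inductive UMask
  | none
  | strictFuture
  | future
  | strictPast
  | past

/-- Position `i` may attend to position `j`. -/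
def UMask.allows {P : Type} [LinearOrder P] : UMask → P → P → Prop
  | .none, _, _ => True
  | .strictFuture, i, j => j < i
  | .future, i, j => j ≤ i
  | .strictPast, i, j => i < j
  | .past, i, j => i ≤ j

inductive TieBreak
  | leftmost
  | rightmost

structure UHead (ι : Type) extends Head ι where
  mask : UMask
  tie : TieBreak

/-- The value at the leftmost (or rightmost) unmasked position of maximal score; `0` if every
position is masked. -/
noncomputable def UHead.attend {ι P : Type} [Fintype ι] [Fintype P] [LinearOrder P]
    (H : UHead ι) (u : P → ι → ℝ) (i : P) : ι → ℝ :=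
  open Classical in
  if h : (H.maximizers H.mask.allows u i).Nonempty then
    match H.tie with
    | .leftmost => H.V (u ((H.maximizers H.mask.allows u i).min' h))
    | .rightmost => H.V (u ((H.maximizers H.mask.allows u i).max' h))
  else 0

/-- A layer is position-wise, or a unique-hard attention layer with finitely many heads, each
with its own mask and choice function. Both have residual connections. -/
inductive ULayer (ι : Type)
  | positionwise (F : FFN ι)
  | attention (heads : List (UHead ι))

noncomputable def ULayer.apply {ι P : Type} [Fintype ι] [Fintype P] [LinearOrder P] :
    ULayer ι → (P → ι → ℝ) → (P → ι → ℝ)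
  | .positionwise F, u => fun i => u i + F.eval (u i)
  | .attention heads, u => fun i => u i + (heads.map fun H => H.attend u i).sum

/-- A masked unique-hard attention transformer encoder with packed outputs: a word embedding
(no position encoding), a fixed list of layers, and an output map that reads, at each position,
a string of length at most `k` over `B` off the final activation vector. -/
structure UHAT (A : Type*) (B : Type*) (ι : Type) where
  embed : A → ι → ℝ
  layers : List (ULayer ι)
  k : ℕ
  out : (ι → ℝ) → List B
  out_length_le : ∀ x, (out x).length ≤ k

/-- The final activation sequence on the input string `w`. -/
noncomputable def UHAT.run {A B : Type*} {ι : Type} [Fintype ι] (T : UHAT A B ι) (w : List A) :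
    Fin w.length → ι → ℝ :=
  T.layers.foldl (fun u L => L.apply u) fun i => T.embed (w.get i)

/-- The output string: the concatenation of the strings at the positions `0, …, |w| - 1`. -/
noncomputable def UHAT.transduce {A B : Type*} {ι : Type} [Fintype ι] (T : UHAT A B ι)
    (w : List A) : List B :=
  (List.ofFn fun i => T.out (T.run w i)).flatten

/-- `f` is computed by some masked unique-hard attention transformer encoder. -/
def UHATComputable {A B : Type*} (f : List A → List B) : Prop :=
  ∃ (ι : Type) (_ : Fintype ι) (T : UHAT A B ι), ∀ w, T.transduce w = f w

/-! ## Masked average-hard attention encoders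

For vector length `n`, the positions `-1, 0, …, n - 1` are represented by `Fin (n + 1)`: the
element `p` stands for the position `p - 1`, so that `0` is the default position. -/

inductive AMask
  | none
  | strictFuture
  | future

/-- Position `i` may attend to position `j`. -/
def AMask.allows {P : Type} [LinearOrder P] : AMask → P → P → Prop
  | .none, _, _ => True
  | .strictFuture, i, j => j < i
  | .future, i, j => j ≤ i

structure AHead (ι : Type) extends Head ι where
  mask : AMask

/-- The average of the values at all unmasked positions of maximal score; `0` if every position
is masked. -/
noncomputable def AHead.attend {ι P : Type} [Fintype ι] [Fintype P] [LinearOrder P]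
    (H : AHead ι) (u : P → ι → ℝ) (i : P) : ι → ℝ :=
  ((H.maximizers H.mask.allows u i).card : ℝ)⁻¹ •
    ∑ j ∈ H.maximizers H.mask.allows u i, H.V (u j)

/-- A layer is position-wise or an average-hard attention layer, both with residual
connections. -/
inductive ALayer (ι : Type)
  | positionwise (F : FFN ι)
  | attention (H : AHead ι)

noncomputable def ALayer.apply {ι P : Type} [Fintype ι] [Fintype P] [LinearOrder P] :
    ALayer ι → (P → ι → ℝ) → (P → ι → ℝ)
  | .positionwise F, u => fun i => u i + F.eval (u i)
  | .attention H, u => fun i => u i + H.attend u i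

/-- The one-hot encoding, over the alphabet `α` with a padding symbol `none`, of the string `w`
padded to length `n`; at the default position it is the zero vector. -/
noncomputable def oneHot {α : Type*} {n : ℕ} (w : List α) (p : Fin (n + 1)) (s : Option α) : ℝ :=
  open Classical in
  Fin.cases (motive := fun _ => ℝ) 0 (fun i : Fin n => if w[(i : ℕ)]? = s then 1 else 0) p

/-- The coordinates that are filled in the initial activation sequence: one for each input symbol
(`none` is the padding symbol) and three for the position encoding. -/
inductive InCoord (A : Type*)
  | sym (s : Option A)
  | pos
  | posq
  | posi

/-- The initial values at position `i = p - 1`: the one-hot encoding of the padded input, and the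
position encoding `i / n`, `(i / n) ^ 2`, `1 / (i + 2)`. -/
noncomputable def inputValue {A : Type*} {n : ℕ} (w : List A) (p : Fin (n + 1)) : InCoord A → ℝ
  | .sym s => oneHot w p s
  | .pos => ((p : ℝ) - 1) / n
  | .posq => (((p : ℝ) - 1) / n) ^ 2
  | .posi => 1 / (((p : ℝ) - 1) + 2)

/-- A masked average-hard attention transformer encoder with position encoding
`i / n`, `(i / n) ^ 2`, `1 / (i + 2)`. The maps `input` and `output` designate the coordinates of
the initial and of the final activation vectors that hold the input and the output. -/
structure AHAT (A : Type*) (B : Type*) (ι : Type) where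
  input : InCoord A ↪ ι
  layers : List (ALayer ι)
  output : Option B ↪ ι

/-- The initial activation sequence; coordinates that are not designated are `0`. -/
noncomputable def AHAT.init {A B : Type*} {ι : Type} (T : AHAT A B ι) (w : List A) (n : ℕ) :
    Fin (n + 1) → ι → ℝ :=
  fun p => Function.extend T.input (inputValue w p) 0

/-- The final activation sequence on the input string `w` padded to length `n`. -/
noncomputable def AHAT.run {A B : Type*} {ι : Type} [Fintype ι] (T : AHAT A B ι) (w : List A)
    (n : ℕ) : Fin (n + 1) → ι → ℝ :=
  T.layers.foldl (fun u L => L.apply u) (T.init w n)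

/-- `T` computes `f`: there is a nondecreasing minimum vector length `q` with `q |w| ≥ |f w|` such
that, for every `n > q |w|` (and `n > |w|`), on `w` padded to length `n` the designated output
coordinates of the final activation sequence hold the one-hot encoding of `f w` padded to
length `n`. -/
def AHAT.Computes {A B : Type*} {ι : Type} [Fintype ι] (T : AHAT A B ι)
    (f : List A → List B) : Prop :=
  ∃ q : ℕ → ℕ, Monotone q ∧ ∀ w : List A, (f w).length ≤ q w.length ∧
    ∀ n : ℕ, w.length < n → q w.length < n →
      ∀ (p : Fin (n + 1)) (t : Option B), T.run w n p (T.output t) = oneHot (f w) p t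

/-- `f` is computed by some masked average-hard attention transformer encoder with position
encoding `i / n`, `(i / n) ^ 2`, `1 / (i + 2)`. -/
def AHATComputable {A B : Type*} (f : List A → List B) : Prop :=
  ∃ (ι : Type) (_ : Fintype ι) (T : AHAT A B ι), T.Computes f

end HardAttention

/-!
The activation vectors of a unique-hard attention encoder range over a finite set that does not
depend on the input: the embedding has finite range, and every layer maps a finite set of vectors
to a finite set. So the encoder is a finite-state device, and an average-hard attention encoder
can simulate it with one-hot encoded states, using the position encoding to break ties and to
place the output.

*Building the network.* A real-valued `Signal` is computable (`Comp`) if it is bounded and can be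
added, in a fresh coordinate, to what any network holds. Computable signals are closed under
affine combinations, ReLU (`comp_ffn`) and average-hard attention whose score is a sum of products
of computable signals (`comp_attn`). For a signal with finitely many values (`FinComp`),
computability is required of the indicators of the values; such signals are closed under `bind`.

*Unique-hard attention.* For a fixed activation vector at the querying position, a head ranks the
finitely many vectors it may see. Scaling these ranks up and adding `± i / n` makes the leftmost
(rightmost) position of maximal rank the only maximizer (`finComp_pickVal_aMask`). Masks `j > i`
and `j ≥ i` are reduced to `j < i` and `j ≤ i` by reversing the sequence: attention with the score
`2 x y - x ^ 2` fetches the value at the position with encoding `y`, and the mirror image of a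
position has the encoding `1 - 2 / n - x` (`Comp.rev`). The case distinction over the vector at
the querying position then simulates the head (`finComp_attend`).

*Output.* Position `j` contributes a string of bounded length that ends, in the concatenation, at
the sum `E j` of the lengths up to `j`. Averaging over the positions up to `j` gives
`(E j - r) / n` up to the factor `1 / (j + 2)`. As this factor is available, `j` can look up the
position with index `E j - r`, and with it `(E j - r) / n` and its square (`exists_lookup`).
Conversely, position `i` finds the `j` with `E j - r = i`, if there is one, and reads the `r`-th
symbol from the end of its string (`compP_hit`); a disjunction over `r` yields the output.
-/

namespace HardAttention

/-! ### Signals and realizability -/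

/-- An input string together with an admissible vector length, for the minimum vector length
`q`. -/
structure Ctx (A : Type*) (q : ℕ → ℕ) where
  word : List A
  n : ℕ
  length_lt : word.length < n
  bound_lt : q word.length < n

/-- A value at every position of every padded input. -/
abbrev Signal (A : Type*) (q : ℕ → ℕ) (R : Type*) := (c : Ctx A q) → Fin (c.n + 1) → R

section Network

variable {A : Type*} {q : ℕ → ℕ}

/-- The initial activation sequence, with the input coordinates placed along `e`. -/
noncomputable def start {ι : Type} (e : InCoord A ↪ ι) (w : List A) (n : ℕ) :
    Fin (n + 1) → ι → ℝ :=
  fun p => Function.extend e (inputValue w p) 0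

/-- A single network keeps its input in place and ends up holding each signal of `S` in some
coordinate. -/
def Realizable (S : Set (Signal A q ℝ)) : Prop :=
  ∃ (ι : Type) (_ : Fintype ι) (e : InCoord A ↪ ι) (Ls : List (ALayer ι)),
    (∀ (x : InCoord A) (c : Ctx A q) (p : Fin (c.n + 1)),
      Ls.foldl (fun u L => L.apply u) (start e c.word c.n) p (e x) = inputValue c.word p x) ∧
    ∀ g ∈ S, ∃ z : ι, ∀ (c : Ctx A q) (p : Fin (c.n + 1)),
      Ls.foldl (fun u L => L.apply u) (start e c.word c.n) p z = g c p

theorem Realizable.mono {S S' : Set (Signal A q ℝ)} (h : Realizable S) (hS : S' ⊆ S) :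
    Realizable S' := by
  obtain ⟨ι, _, e, Ls, h1, h2⟩ := h
  exact ⟨ι, _, e, Ls, h1, fun g hg => h2 g (hS hg)⟩

instance [Finite A] : Finite (InCoord A) := by
  refine Finite.of_injective (β := Option A ⊕ Fin 3)
    (fun | .sym s => .inl s | .pos => .inr 0 | .posq => .inr 1 | .posi => .inr 2) ?_
  rintro (_ | _ | _ | _) (_ | _ | _ | _) <;> simp

theorem realizable_empty [Finite A] : Realizable (∅ : Set (Signal A q ℝ)) := by
  obtain ⟨m, ⟨e⟩⟩ := Finite.exists_equiv_fin (InCoord A)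
  refine ⟨Fin m, inferInstance, e.toEmbedding, [], fun x c p => ?_, by simp⟩
  exact e.injective.extend_apply _ _ _

/-! ### Adding fresh coordinates to a network -/

/-- The same layer with additional coordinates, which it neither reads nor writes. -/
noncomputable def ALayer.lift {ι : Type} (κ : Type) : ALayer ι → ALayer (ι ⊕ κ)
  | .positionwise F => .positionwise
      { hidden := F.hidden
        W₁ := Matrix.fromCols F.W₁ 0
        b₁ := F.b₁
        W₂ := Matrix.fromRows F.W₂ 0
        b₂ := Sum.elim F.b₂ 0 }
  | .attention H =>
      let res : (ι ⊕ κ → ℝ) →ₗ[ℝ] (ι → ℝ) := LinearMap.funLeft ℝ ℝ Sum.inl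
      let ext : (ι → ℝ) →ₗ[ℝ] (ι ⊕ κ → ℝ) := LinearMap.pi (Sum.elim LinearMap.proj 0)
      .attention
        { Q := ext ∘ₗ H.Q ∘ₗ res
          K := ext ∘ₗ H.K ∘ₗ res
          V := ext ∘ₗ H.V ∘ₗ res
          mask := H.mask }

theorem ALayer.lift_apply {ι κ P : Type} [Fintype ι] [Fintype κ] [Fintype P] [LinearOrder P]
    (L : ALayer ι) (u : P → ι → ℝ) :
    (L.lift κ).apply (fun p => Sum.elim (u p) 0) = fun p => Sum.elim (L.apply u p) 0 := by
  cases L with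
  | positionwise F =>
    funext p z
    rcases z with z | z <;>
      simp [ALayer.lift, ALayer.apply, FFN.eval, Matrix.fromRows_mulVec, Matrix.fromCols_mulVec]
  | attention H =>
    have hext : ∀ (T : (ι → ℝ) →ₗ[ℝ] (ι → ℝ)) (x : ι → ℝ),
        ((LinearMap.pi (Sum.elim LinearMap.proj 0) : (ι → ℝ) →ₗ[ℝ] (ι ⊕ κ → ℝ)) ∘ₗ T ∘ₗ
          LinearMap.funLeft ℝ ℝ (Sum.inl : ι → ι ⊕ κ)) (Sum.elim x 0) = Sum.elim (T x) 0 := by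
      intro T x
      have : (LinearMap.funLeft ℝ ℝ (Sum.inl : ι → ι ⊕ κ)) (Sum.elim x 0) = x := by
        funext z; simp [LinearMap.funLeft_apply]
      funext z
      rcases z with z | z <;> simp [this]
    funext p z
    have hmax : ∀ H' : Head (ι ⊕ κ),
        (∀ x y : ι → ℝ, H'.score (Sum.elim x 0) (Sum.elim y 0) = H.score x y) →
        H'.maximizers H.mask.allows (fun p => Sum.elim (u p) 0) p =
          H.maximizers H.mask.allows u p := by
      intro H' h
      ext j
      simp only [Head.maximizers, Finset.mem_filter, h]
    simp only [ALayer.lift, ALayer.apply, AHead.attend]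
    rw [hmax]
    · simp only [hext]
      rcases z with z | z <;> simp [Finset.sum_apply]
    · intro x y
      simp only [Head.score, hext]
      simp [dotProduct]

theorem start_lift {ι : Type} (κ : Type) (e : InCoord A ↪ ι) (w : List A) (n : ℕ) :
    start (e.trans ⟨Sum.inl, Sum.inl_injective⟩ : InCoord A ↪ ι ⊕ κ) w n =
      fun p => Sum.elim (start e w n p) 0 := by
  funext p z
  rcases z with z | z
  · by_cases hz : ∃ x, e x = z
    · obtain ⟨x, rfl⟩ := hz
      have := (e.trans ⟨Sum.inl, Sum.inl_injective⟩ : InCoord A ↪ ι ⊕ κ).injective.extend_apply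
        (inputValue w p) 0 x
      simp only [start, Sum.elim_inl, e.injective.extend_apply]
      exact this
    · simp only [start, Sum.elim_inl]
      rw [Function.extend_apply' _ _ _ hz, Function.extend_apply']
      · rfl
      · rintro ⟨x, hx⟩
        exact hz ⟨x, Sum.inl_injective hx⟩
  · simp only [start, Sum.elim_inr]
    rw [Function.extend_apply']
    · rfl
    · rintro ⟨x, hx⟩
      simp at hx

/-- A network can be followed by a layer that writes into fresh coordinates. -/
theorem foldl_lift_concat {ι : Type} (κ : Type) [Fintype ι] [Fintype κ] (e : InCoord A ↪ ι)
    (Ls : List (ALayer ι)) (L : ALayer (ι ⊕ κ)) (w : List A) (n : ℕ) :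
    (Ls.map (ALayer.lift κ) ++ [L]).foldl (fun u L => L.apply u)
        (start (e.trans ⟨Sum.inl, Sum.inl_injective⟩) w n) =
      L.apply fun p => Sum.elim (Ls.foldl (fun u L => L.apply u) (start e w n) p) 0 := by
  rw [start_lift, List.foldl_append, List.foldl_cons, List.foldl_nil]
  congr 1
  generalize start e w n = u
  induction Ls generalizing u with
  | nil => rfl
  | cons M Ls ih => simp only [List.map_cons, List.foldl_cons, ALayer.lift_apply, ih]

/-- A signal that some layer can compute from coordinates holding the signals of `S` can be added
to `S`. -/
theorem Realizable.insert_of_layer {S : Set (Signal A q ℝ)} {g : Signal A q ℝ}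
    (hS : Realizable S)
    (h : ∀ (ι : Type) [Fintype ι] (u : (c : Ctx A q) → Fin (c.n + 1) → ι → ℝ),
      (∀ h ∈ S, ∃ z : ι, ∀ c p, u c p z = h c p) →
      ∃ L : ALayer (ι ⊕ Unit), ∀ c p,
        L.apply (fun p => Sum.elim (u c p) 0) p = Sum.elim (u c p) (fun _ => g c p)) :
    Realizable (insert g S) := by
  obtain ⟨ι, _, e, Ls, h1, h2⟩ := hS
  obtain ⟨L, hL⟩ := h ι (fun c => Ls.foldl (fun u L => L.apply u) (start e c.word c.n)) h2
  refine ⟨ι ⊕ Unit, inferInstance, e.trans ⟨Sum.inl, Sum.inl_injective⟩,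
    Ls.map (ALayer.lift Unit) ++ [L], fun x c p => ?_, ?_⟩
  · rw [foldl_lift_concat, hL]
    simpa using h1 x c p
  · rintro g' (rfl | hg')
    · refine ⟨Sum.inr (), fun c p => ?_⟩
      rw [foldl_lift_concat, hL]
      simp
    · obtain ⟨z, hz⟩ := h2 g' hg'
      refine ⟨Sum.inl z, fun c p => ?_⟩
      rw [foldl_lift_concat, hL]
      simpa using hz c p

/-! ### Computable signals -/

/-- A bounded signal that can be added to the signals held by any network. Quantifying over all
networks makes closure properties provable without running networks in parallel, and boundedness
is what allows a ReLU to cut a signal off outside of a given set of positions (`Comp.ite`). -/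
def Comp (g : Signal A q ℝ) : Prop :=
  (∃ M : ℝ, ∀ c p, |g c p| ≤ M) ∧ ∀ S, Realizable S → Realizable (insert g S)

/-- The positions `j` with `M i j` at which `r` is maximal among all positions `j'` with
`M i j'`. -/
noncomputable def bestSet {P : Type} [Fintype P] (M : P → P → Prop) (r : P → ℝ) (i : P) :
    Finset P :=
  open Classical in
  Finset.univ.filter fun j => M i j ∧ ∀ j', M i j' → r j' ≤ r j

/-- The average of `v` over the best positions for the score `∑ s, Q s p * K s j`. -/
noncomputable def attn (mask : AMask) {m : ℕ} (Q K : Fin m → Signal A q ℝ)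
    (v : Signal A q ℝ) : Signal A q ℝ :=
  fun c p =>
    ((bestSet mask.allows (fun j => ∑ s, Q s c p * K s c j) p).card : ℝ)⁻¹ *
      ∑ j ∈ bestSet mask.allows (fun j => ∑ s, Q s c p * K s c j) p, v c j

theorem Comp.add_family {S : Set (Signal A q ℝ)} (hS : Realizable S) {τ : Type*}
    [Finite τ] {h : τ → Signal A q ℝ} (hh : ∀ s, Comp (h s)) : Realizable (S ∪ Set.range h) := by
  obtain ⟨m, ⟨e⟩⟩ := Finite.exists_equiv_fin τ
  suffices H : ∀ g : Fin m → Signal A q ℝ, (∀ s, Comp (g s)) → Realizable (S ∪ Set.range g) by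
    simpa using H (h ∘ e.symm) fun s => hh _
  clear hh h e
  intro h hh
  induction m with
  | zero => simpa using hS
  | succ m ih =>
    refine ((hh 0).2 _ (ih (fun s => h s.succ) fun s => hh s.succ)).mono ?_
    rintro g (hg | ⟨s, rfl⟩)
    · exact Or.inr (Or.inl hg)
    · cases s using Fin.cases with
      | zero => exact Or.inl rfl
      | succ s => exact Or.inr (Or.inr ⟨s, rfl⟩)

/-- A signal computed from finitely many computable signals by one layer is computable. -/
theorem Comp.of_layer {g : Signal A q ℝ} {τ : Type*} [Finite τ]
    {h : τ → Signal A q ℝ} (hh : ∀ s, Comp (h s)) (hb : ∃ M : ℝ, ∀ c p, |g c p| ≤ M)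
    (H : ∀ (ι : Type) [Fintype ι] (u : (c : Ctx A q) → Fin (c.n + 1) → ι → ℝ) (z : τ → ι),
      (∀ s c p, u c p (z s) = h s c p) →
      ∃ L : ALayer (ι ⊕ Unit), ∀ c p,
        L.apply (fun p => Sum.elim (u c p) 0) p = Sum.elim (u c p) (fun _ => g c p)) :
    Comp g := by
  refine ⟨hb, fun S hS => ?_⟩
  refine ((Comp.add_family hS hh).insert_of_layer fun ι _ u hu => ?_).mono
    (Set.insert_subset_insert Set.subset_union_left)
  have : ∀ s, ∃ z : ι, ∀ c p, u c p z = h s c p := fun s => hu _ (Or.inr ⟨s, rfl⟩)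
  choose z hz using this
  exact H ι u z hz

theorem Ctx.n_pos (c : Ctx A q) : (0 : ℝ) < c.n := by
  exact_mod_cast Nat.zero_lt_of_lt c.length_lt

theorem abs_inputValue_pos_le (c : Ctx A q) (p : Fin (c.n + 1)) :
    |inputValue c.word p .pos| ≤ 1 := by
  have hn : (1 : ℝ) ≤ c.n := by exact_mod_cast Nat.one_le_of_lt c.length_lt
  have hp : (p : ℝ) ≤ c.n := by exact_mod_cast Fin.is_le p
  have hp0 : (0 : ℝ) ≤ p := by positivity
  rw [inputValue, abs_div, abs_of_pos c.n_pos, div_le_one c.n_pos, abs_le]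
  constructor <;> linarith

theorem comp_input {x : InCoord A} : Comp (A := A) (q := q)
    fun c p => inputValue c.word p x := by
  refine ⟨⟨1, fun c p => ?_⟩, ?_⟩
  · cases x with
    | sym s =>
      cases p using Fin.cases with
      | zero => simp [inputValue, oneHot]
      | succ i => simp only [inputValue, oneHot, Fin.cases_succ]; split_ifs <;> simp
    | pos => exact abs_inputValue_pos_le c p
    | posq =>
      simpa only [inputValue, abs_pow] using
        pow_le_one₀ (abs_nonneg _) (abs_inputValue_pos_le c p)
    | posi =>
      have hp0 : (0 : ℝ) ≤ p := by positivity
      simp only [inputValue]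
      rw [abs_of_nonneg (by apply div_nonneg <;> linarith), div_le_one (by linarith)]
      linarith
  · rintro S ⟨ι, _, e, Ls, h1, h2⟩
    refine ⟨ι, _, e, Ls, h1, ?_⟩
    rintro g (rfl | hg)
    · exact ⟨e x, fun c p => h1 x c p⟩
    · exact h2 g hg

/-- The combination of two signals by a feed-forward network with two hidden units. -/
theorem comp_ffn {h₁ h₂ : Signal A q ℝ} (H₁ : Comp h₁) (H₂ : Comp h₂) (a b d s : Fin 2 → ℝ) :
    Comp fun c p => ∑ t, s t * max 0 (a t * h₁ c p + b t * h₂ c p + d t) := by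
  obtain ⟨M₁, hM₁⟩ := H₁.1
  obtain ⟨M₂, hM₂⟩ := H₂.1
  refine Comp.of_layer (h := ![h₁, h₂]) (by simp [Fin.forall_fin_two, H₁, H₂])
    ⟨∑ t, |s t| * (|a t| * M₁ + |b t| * M₂ + |d t|), fun c p => ?_⟩ fun ι _ u z hz => ?_
  · refine (Finset.abs_sum_le_sum_abs _ _).trans (Finset.sum_le_sum fun t _ => ?_)
    rw [abs_mul]
    gcongr
    have h1 : |a t * h₁ c p| ≤ |a t| * M₁ := by
      rw [abs_mul]; gcongr; exact hM₁ c p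
    have h2 : |b t * h₂ c p| ≤ |b t| * M₂ := by
      rw [abs_mul]; gcongr; exact hM₂ c p
    have h3 := abs_add_three (a t * h₁ c p) (b t * h₂ c p) (d t)
    rw [abs_of_nonneg (le_max_left _ _)]
    refine max_le ?_ ?_
    · linarith [abs_nonneg (a t * h₁ c p + b t * h₂ c p + d t)]
    · linarith [le_abs_self (a t * h₁ c p + b t * h₂ c p + d t)]
  · classical
    refine ⟨.positionwise
      { hidden := 2
        W₁ := Matrix.of fun t => Sum.elim
          (a t • Pi.single (z 0) (1 : ℝ) + b t • Pi.single (z 1) (1 : ℝ)) 0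
        b₁ := d
        W₂ := Matrix.fromRows 0 (Matrix.of fun _ => s)
        b₂ := 0 }, fun c p => ?_⟩
    have h1 := hz 0 c p
    have h2 := hz 1 c p
    simp only [Matrix.cons_val_zero, Matrix.cons_val_one] at h1 h2
    have key : ∀ t, (Sum.elim
        (a t • Pi.single (z 0) (1 : ℝ) + b t • Pi.single (z 1) (1 : ℝ)) 0 : ι ⊕ Unit → ℝ) ⬝ᵥ
          Sum.elim (u c p) 0 = a t * h₁ c p + b t * h₂ c p := by
      intro t
      rw [sumElim_dotProduct_sumElim, add_dotProduct, smul_dotProduct, smul_dotProduct,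
        single_dotProduct, single_dotProduct, h1, h2]
      simp only [one_mul, smul_eq_mul, zero_dotProduct, add_zero]
    funext x
    rcases x with x | x
    · simp [ALayer.apply, FFN.eval, Matrix.fromRows_mulVec]
    · simp [ALayer.apply, FFN.eval, Matrix.fromRows_mulVec, Matrix.mulVec, key]

theorem abs_attn_le {mask : AMask} {m : ℕ} {Q K : Fin m → Signal A q ℝ} {v : Signal A q ℝ}
    {M : ℝ} (hM : ∀ c p, |v c p| ≤ M) (c : Ctx A q) (p : Fin (c.n + 1)) :
    |attn mask Q K v c p| ≤ M := by
  have hM0 : 0 ≤ M := (abs_nonneg _).trans (hM c p)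
  rw [attn, abs_mul, abs_inv, Nat.abs_cast]
  set s := bestSet mask.allows (fun j => ∑ s, Q s c p * K s c j) p
  rcases s.eq_empty_or_nonempty with hs | hs
  · simpa [hs] using hM0
  · rw [inv_mul_le_iff₀ (by exact_mod_cast hs.card_pos)]
    refine (Finset.abs_sum_le_sum_abs _ _).trans ?_
    simpa using Finset.sum_le_card_nsmul s _ M fun j _ => hM c j

/-- A single head suffices for a sum of products of coordinates: with the identity as the query
map, every bilinear form is an attention score. -/
theorem comp_attn (mask : AMask) {m : ℕ} {Q K : Fin m → Signal A q ℝ} {v : Signal A q ℝ}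
    (hQ : ∀ s, Comp (Q s)) (hK : ∀ s, Comp (K s)) (hv : Comp v) : Comp (attn mask Q K v) := by
  obtain ⟨M, hM⟩ := hv.1
  refine Comp.of_layer (h := Sum.elim (fun _ : Unit => v) (Sum.elim Q K)) ?_
    ⟨M, abs_attn_le hM⟩ fun ι _ u z hz => ?_
  · rintro (_ | s | s)
    exacts [hv, hQ s, hK s]
  · classical
    have hzv : ∀ c p, u c p (z (.inl ())) = v c p := hz _
    have hzQ : ∀ s c p, u c p (z (.inr (.inl s))) = Q s c p := fun s => hz _
    have hzK : ∀ s c p, u c p (z (.inr (.inr s))) = K s c p := fun s => hz _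
    let H : AHead (ι ⊕ Unit) :=
      { Q := LinearMap.id
        K := LinearMap.pi (Sum.elim (fun x => ∑ s : Fin m,
          if z (.inr (.inl s)) = x then
            LinearMap.proj (Sum.inl (z (.inr (.inr s)))) else 0) 0)
        V := LinearMap.pi (Sum.elim 0 fun _ => LinearMap.proj (Sum.inl (z (.inl ()))))
        mask := mask }
    refine ⟨.attention H, fun c p => ?_⟩
    have hscore : ∀ p j, H.score (Sum.elim (u c p) 0) (Sum.elim (u c j) 0) =
        ∑ s, Q s c p * K s c j := by
      intro p j
      simp only [H, Head.score, LinearMap.id_apply, dotProduct, Fintype.sum_sum_type,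
        LinearMap.pi_apply, Sum.elim_inl, LinearMap.sum_apply, Finset.mul_sum]
      rw [Finset.sum_comm]
      simp only [Sum.elim_inr, Pi.zero_apply, zero_mul, Finset.sum_const_zero, add_zero]
      refine Finset.sum_congr rfl fun s _ => ?_
      rw [Finset.sum_eq_single (z (.inr (.inl s)))]
      · simp [hzQ, hzK]
      · intro x _ hx
        simp [hx.symm]
      · simp
    have hmax : H.maximizers H.mask.allows (fun p => Sum.elim (u c p) 0) p =
        bestSet mask.allows (fun j => ∑ s, Q s c p * K s c j) p := by
      simp only [Head.maximizers, bestSet, hscore]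
      rfl
    funext x
    simp only [ALayer.apply, AHead.attend, hmax, attn]
    rcases x with x | x <;> simp [H, hzv]

/-- Nonnegative computable signals, finitely many of them, are the output of one encoder: they
are copied into fresh coordinates, which makes the output coordinates pairwise distinct. -/
theorem exists_aHAT [Finite A] {B : Type*} [Finite B] {g : Option B → Signal A q ℝ}
    (hg : ∀ t, Comp (g t)) (h0 : ∀ t c p, 0 ≤ g t c p) :
    ∃ (ι : Type) (_ : Fintype ι) (T : AHAT A B ι), ∀ (c : Ctx A q) (p : Fin (c.n + 1)) t,
      T.run c.word c.n p (T.output t) = g t c p := by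
  classical
  obtain ⟨m, ⟨e'⟩⟩ := Finite.exists_equiv_fin (Option B)
  obtain ⟨ι, _, e, Ls, -, h2⟩ :=
    Comp.add_family (realizable_empty (A := A) (q := q)) (h := fun s => g (e'.symm s))
      fun s => hg _
  have : ∀ s : Fin m, ∃ z : ι, ∀ (c : Ctx A q) (p : Fin (c.n + 1)),
      Ls.foldl (fun u L => L.apply u) (start e c.word c.n) p z = g (e'.symm s) c p :=
    fun s => h2 _ (Or.inr ⟨s, rfl⟩)
  choose z hz using this
  let L : ALayer (ι ⊕ Fin m) := .positionwise
    { hidden := m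
      W₁ := Matrix.of fun s => Sum.elim (Pi.single (z s) (1 : ℝ)) 0
      b₁ := 0
      W₂ := Matrix.fromRows 0 1
      b₂ := 0 }
  refine ⟨ι ⊕ Fin m, inferInstance,
    { input := e.trans ⟨Sum.inl, Sum.inl_injective⟩
      layers := Ls.map (ALayer.lift (Fin m)) ++ [L]
      output := e'.toEmbedding.trans ⟨Sum.inr, Sum.inr_injective⟩ }, fun c p t => ?_⟩
  change (Ls.map (ALayer.lift (Fin m)) ++ [L]).foldl (fun u L => L.apply u)
    (start (e.trans ⟨Sum.inl, Sum.inl_injective⟩) c.word c.n) p (Sum.inr (e' t)) = _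
  rw [foldl_lift_concat]
  have hzt := hz (e' t) c p
  generalize Ls.foldl (fun u L => L.apply u) (start e c.word c.n) = u at hzt ⊢
  simp only [L, ALayer.apply, FFN.eval, Matrix.fromRows_mulVec, Pi.add_apply, Sum.elim_inr,
    Matrix.one_mulVec, Matrix.mulVec, Matrix.of_apply, Pi.zero_apply]
  rw [sumElim_dotProduct_sumElim, single_dotProduct, hzt]
  simp [h0]

end Network

section Closure

variable {A : Type*} {q : ℕ → ℕ}

/-! ### Arithmetic and Boolean operations on signals -/

theorem Comp.congr {g h : Signal A q ℝ} (hg : Comp g) (e : ∀ c p, g c p = h c p) : Comp h := by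
  have : g = h := funext fun c => funext fun p => e c p
  rwa [← this]

theorem Comp.affine {g h : Signal A q ℝ} (hg : Comp g) (hh : Comp h) (a b d : ℝ) :
    Comp fun c p => a * g c p + b * h c p + d := by
  -- `x = max 0 x - max 0 (-x)`
  refine (comp_ffn hg hh ![a, -a] ![b, -b] ![d, -d] ![1, -1]).congr fun c p => ?_
  simp only [Fin.sum_univ_two, Matrix.cons_val_zero, Matrix.cons_val_one]
  rcases le_total 0 (a * g c p + b * h c p + d) with H | H
  · rw [max_eq_right H, max_eq_left (by linarith)]; ring
  · rw [max_eq_left H, max_eq_right (by linarith)]; ring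

theorem Comp.relu {g h : Signal A q ℝ} (hg : Comp g) (hh : Comp h) (a b d : ℝ) :
    Comp fun c p => max 0 (a * g c p + b * h c p + d) :=
  (comp_ffn hg hh (fun _ => a) (fun _ => b) (fun _ => d) ![1, 0]).congr fun c p => by
    simp [Fin.sum_univ_two]

theorem Comp.add {g h : Signal A q ℝ} (hg : Comp g) (hh : Comp h) :
    Comp fun c p => g c p + h c p :=
  (hg.affine hh 1 1 0).congr fun c p => by ring

theorem Comp.const_mul {g : Signal A q ℝ} (hg : Comp g) (a : ℝ) :
    Comp fun c p => a * g c p :=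
  (hg.affine hg a 0 0).congr fun c p => by ring

open Classical in
/-- The predicate `P` has a computable indicator. -/
def CompP (P : Signal A q Prop) : Prop :=
  Comp fun c p => if P c p then 1 else 0

theorem CompP.congr {P Q : Signal A q Prop} (hP : CompP P) (e : ∀ c p, P c p ↔ Q c p) :
    CompP Q := by
  classical
  exact Comp.congr hP fun c p => if_congr (e c p) rfl rfl

theorem CompP.not {P : Signal A q Prop} (hP : CompP P) : CompP fun c p => ¬ P c p := by
  classical
  refine (Comp.affine hP hP (-1) 0 1).congr fun c p => ?_
  by_cases h : P c p <;> simp [h]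

open Classical in
/-- Since `v` is bounded, it can be cut off by a ReLU outside of `P`. -/
theorem Comp.ite {P : Signal A q Prop} {v : Signal A q ℝ} (hv : Comp v) (hP : CompP P) :
    Comp fun c p => if P c p then v c p else 0 := by
  obtain ⟨M, hM⟩ := hv.1
  -- with `d` the indicator of `P`, this is `max 0 (v + 2 * M * d - M) - M * d`
  refine ((Comp.relu hv hP 1 (2 * M) (-M)).affine hP 1 (-M) 0).congr fun c p => ?_
  have := abs_le.1 (hM c p)
  by_cases hp : P c p
  · simp only [hp, if_true]
    rw [max_eq_right (by linarith)]; ring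
  · simp only [hp, if_false]
    rw [max_eq_left (by linarith)]; ring

theorem CompP.and {P Q : Signal A q Prop} (hP : CompP P) (hQ : CompP Q) :
    CompP fun c p => P c p ∧ Q c p := by
  classical
  refine (Comp.ite hQ hP).congr fun c p => ?_
  by_cases h : P c p <;> simp [h]

theorem comp_const (r : ℝ) : Comp (A := A) (q := q) fun _ _ => r :=
  ((comp_input (x := .pos)).affine (comp_input (x := .pos)) 0 0 r).congr fun c p => by ring

theorem Comp.sum {α : Type*} (s : Finset α) {g : α → Signal A q ℝ} (hg : ∀ x, Comp (g x)) :
    Comp fun c p => ∑ x ∈ s, g x c p := by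
  classical
  induction s using Finset.induction_on with
  | empty => simpa using comp_const 0
  | insert x s hx ih => simpa [Finset.sum_insert hx] using (hg x).add ih

theorem compP_const (P : Prop) : CompP (A := A) (q := q) fun _ _ => P :=
  comp_const _

theorem CompP.exists_mem {α : Type*} (s : Finset α) {P : α → Signal A q Prop}
    (hP : ∀ x, CompP (P x)) : CompP fun c p => ∃ x ∈ s, P x c p := by
  classical
  induction s using Finset.induction_on with
  | empty => simpa using compP_const False
  | insert x s hx ih =>
    refine (((hP x).not).and ih.not).not.congr fun c p => ?_
    simp only [Finset.mem_insert, exists_eq_or_imp, not_and_or, not_not]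

/-! ### Attention with a single best position -/

theorem attn_eq_of_unique {mask : AMask} {m : ℕ} {Q K : Fin m → Signal A q ℝ}
    {v : Signal A q ℝ} {c : Ctx A q} {p : Fin (c.n + 1)} (j : Fin (c.n + 1))
    (hj : mask.allows p j)
    (h : ∀ j', mask.allows p j' → j' ≠ j →
      ∑ s, Q s c p * K s c j' < ∑ s, Q s c p * K s c j) :
    attn mask Q K v c p = v c j := by
  have : bestSet mask.allows (fun j => ∑ s, Q s c p * K s c j) p = {j} := by
    ext j'
    simp only [bestSet, Finset.mem_filter, Finset.mem_univ, true_and, Finset.mem_singleton]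
    constructor
    · rintro ⟨h1, h2⟩
      by_contra hne
      exact (h2 j hj).not_gt (h j' h1 hne)
    · rintro rfl
      refine ⟨hj, fun j'' hj'' => ?_⟩
      by_cases hne : j'' = j'
      · rw [hne]
      · exact (h j'' hj'' hne).le
  simp [attn, this]

theorem attn_eq_zero {mask : AMask} {m : ℕ} {Q K : Fin m → Signal A q ℝ}
    {v : Signal A q ℝ} {c : Ctx A q} {p : Fin (c.n + 1)} (h : ∀ j, ¬ mask.allows p j) :
    attn mask Q K v c p = 0 := by
  have : bestSet mask.allows (fun j => ∑ s, Q s c p * K s c j) p = ∅ := by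
    ext j
    simp [bestSet, h]
  simp [attn, this]

/-! ### Finite-state signals -/

/-- A signal with finitely many values, each of which is recognized by a computable
indicator. -/
structure FinComp {R : Type*} (s : Signal A q R) : Prop where
  exists_range : ∃ X : Finset R, ∀ c p, s c p ∈ X
  compP : ∀ x, CompP fun c p => s c p = x

theorem FinComp.congr {R : Type*} {s t : Signal A q R} (hs : FinComp s)
    (e : ∀ c p, s c p = t c p) : FinComp t := by
  have : s = t := funext fun c => funext fun p => e c p
  rwa [← this]

theorem FinComp.select {R : Type*} {s : Signal A q R} (hs : FinComp s)
    {v : R → Signal A q ℝ} (hv : ∀ x, Comp (v x)) : Comp fun c p => v (s c p) c p := by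
  classical
  obtain ⟨X, hX⟩ := hs.exists_range
  refine (Comp.sum X (fun x => (hv x).ite (hs.compP x))).congr fun c p => ?_
  rw [Finset.sum_eq_single (s c p)]
  · simp
  · intro x _ hx; simp [hx.symm]
  · intro h; exact absurd (hX c p) h

theorem FinComp.const {R : Type*} (x : R) : FinComp (A := A) (q := q) fun _ _ => x where
  exists_range := ⟨{x}, by simp⟩
  compP y := comp_const _

theorem FinComp.compP_pred {R : Type*} {s : Signal A q R} (hs : FinComp s) (P : R → Prop) :
    CompP fun c p => P (s c p) := by
  classical
  exact hs.select fun x => compP_const (P x)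

/-- The values of `s` may determine which of finitely many finite-state signals is read. -/
theorem FinComp.bind {R S : Type*} {s : Signal A q R} (hs : FinComp s)
    {t : R → Signal A q S} (ht : ∀ x, FinComp (t x)) : FinComp fun c p => t (s c p) c p where
  exists_range := by
    classical
    obtain ⟨X, hX⟩ := hs.exists_range
    choose Y hY using fun x => (ht x).exists_range
    exact ⟨X.biUnion Y, fun c p => Finset.mem_biUnion.2 ⟨_, hX c p, hY _ c p⟩⟩
  compP y := hs.select fun x => (ht x).compP y

theorem FinComp.map {R S : Type*} {s : Signal A q R} (hs : FinComp s) (f : R → S) :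
    FinComp fun c p => f (s c p) :=
  hs.bind fun x => FinComp.const (f x)

theorem FinComp.map₂ {R S U : Type*} {s : Signal A q R} {t : Signal A q S} (hs : FinComp s)
    (ht : FinComp t) (f : R → S → U) : FinComp fun c p => f (s c p) (t c p) :=
  hs.bind fun x => ht.map (f x)

theorem FinComp.real {R : Type*} {s : Signal A q R} (hs : FinComp s) (f : R → ℝ) :
    Comp fun c p => f (s c p) :=
  hs.select fun x => comp_const (f x)

/-- The indicator of one value is determined by the indicators of the other ones. -/
theorem FinComp.of_ne {R : Type*} {s : Signal A q R} (X : Finset R) (hX : ∀ c p, s c p ∈ X)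
    (d : R) (h : ∀ x, x ≠ d → CompP fun c p => s c p = x) : FinComp s where
  exists_range := ⟨X, hX⟩
  compP x := by
    classical
    by_cases hx : x = d
    · subst hx
      have h' : ∀ y, CompP fun c p => y ≠ x ∧ s c p = y := by
        intro y
        by_cases hy : y = x
        · simpa [hy] using compP_const False
        · simpa [hy] using h y hy
      refine (CompP.exists_mem X h').not.congr fun c p => ?_
      grind
    · exact h x hx

/-! ### Quantities available at every position -/

/-- The position encoding `i / n`, where `p = i + 1`. -/
noncomputable def posSig : Signal A q ℝ := fun c p => inputValue c.word p .pos

theorem comp_posSig : Comp (posSig : Signal A q ℝ) := comp_input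

/-- `2 / (i + 2) - 1` is `1` at the default position `i = -1` and at most `0` elsewhere. -/
theorem compP_default : CompP (A := A) (q := q) fun _ p => p = 0 := by
  refine (Comp.relu (comp_input (x := .posi)) (comp_const 0) 2 0 (-1)).congr fun c p => ?_
  simp only [inputValue]
  by_cases hp : p = 0
  · subst hp; norm_num
  · have : (1 : ℝ) ≤ p := by
      exact_mod_cast Nat.one_le_iff_ne_zero.2 (fun h => hp (Fin.ext h))
    rw [if_neg hp, max_eq_left]
    have : 1 / ((p : ℝ) - 1 + 2) ≤ 1 / 2 := by
      apply one_div_le_one_div_of_le <;> linarith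
    linarith

/-- The value of a signal at the default position can be made available everywhere. -/
theorem Comp.at_default {v : Signal A q ℝ} (hv : Comp v) : Comp fun c _ => v c 0 := by
  refine (comp_attn .none (m := 1) (Q := fun _ _ _ => 1) (fun _ => comp_const 1)
    (fun _ => compP_default) hv).congr fun c p => ?_
  refine attn_eq_of_unique 0 trivial fun j _ hj => ?_
  simp [hj]

/-- The position encoding `i / n` is `-1 / n` at the default position. -/
theorem comp_inv : Comp (A := A) (q := q) fun c _ => 1 / c.n := by
  refine (comp_posSig.at_default.const_mul (-1)).congr fun c p => ?_
  simp only [posSig, inputValue, Fin.val_zero, Nat.cast_zero]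
  ring

/-! ### Reversal -/

/-- Position `p` looks up its mirror image, which maximizes `2 x y - x ^ 2` for the query value
`y` equal to the position encoding of the mirror image. -/
theorem Comp.rev {v : Signal A q ℝ} (hv : Comp v) : Comp fun c p => v c p.rev := by
  have hy : Comp (A := A) (q := q) fun c p => (-1) * posSig c p + (-2) * (1 / c.n) + 1 :=
    comp_posSig.affine comp_inv _ _ _
  refine (comp_attn .none (m := 2)
    (Q := ![fun c p => (-1) * posSig c p + (-2) * (1 / c.n) + 1, fun _ _ => 1])
    (K := ![fun c p => 2 * posSig c p, fun c p => (-1) * inputValue c.word p .posq])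
    (v := v) ?_ ?_ hv).congr fun c p => ?_
  · exact Fin.forall_fin_two.2 ⟨hy, comp_const 1⟩
  · exact Fin.forall_fin_two.2 ⟨comp_posSig.const_mul 2, comp_input.const_mul (-1)⟩
  · refine attn_eq_of_unique p.rev trivial fun j _ hj => ?_
    simp only [Fin.sum_univ_two, Matrix.cons_val_zero, Matrix.cons_val_one, posSig, inputValue]
    have hn := c.n_pos
    have hrev : ((p.rev : ℕ) : ℝ) = c.n - p := by
      rw [Fin.val_rev, Nat.cast_sub (by omega)]; push_cast; ring
    have e : -1 * (((p : ℝ) - 1) / c.n) + -2 * (1 / c.n) + 1 = ((p.rev : ℕ) - 1) / (c.n : ℝ) := by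
      rw [hrev]; field_simp; ring
    rw [e]
    have hne : ((p.rev : ℕ) - 1) / (c.n : ℝ) - ((j : ℝ) - 1) / c.n ≠ 0 := by
      rw [← sub_div, div_ne_zero_iff]
      refine ⟨fun h => hj (Fin.ext ?_), hn.ne'⟩
      have : (j : ℝ) = (p.rev : ℕ) := by linarith
      exact_mod_cast this
    have := pow_pos (abs_pos.2 hne) 2
    rw [sq_abs] at this
    linarith

theorem FinComp.rev {R : Type*} {s : Signal A q R} (hs : FinComp s) :
    FinComp fun c p => s c p.rev where
  exists_range := by
    obtain ⟨X, hX⟩ := hs.exists_range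
    exact ⟨X, fun c p => hX c _⟩
  compP x := Comp.rev (hs.compP x)

end Closure

/-! ### Unique-hard selection -/

/-- `j` is not worse than `j'` among positions of equal score. -/
def TieBreak.prefers {P : Type} [LinearOrder P] : TieBreak → P → P → Prop
  | .leftmost, j, j' => j ≤ j'
  | .rightmost, j, j' => j' ≤ j

/-- `j` is the leftmost (or rightmost) unmasked position of maximal score. -/
def IsPick {P : Type} [LinearOrder P] (M : P → P → Prop) (tie : TieBreak) (r : P → ℝ)
    (i j : P) : Prop :=
  M i j ∧ ∀ j', M i j' → r j' < r j ∨ (r j' = r j ∧ tie.prefers j j')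

theorem mem_bestSet {P : Type} [Fintype P] {M : P → P → Prop} {r : P → ℝ} {i j : P} :
    j ∈ bestSet M r i ↔ M i j ∧ ∀ j', M i j' → r j' ≤ r j := by
  simp [bestSet]

theorem bestSet_nonempty {P : Type} [Fintype P] {M : P → P → Prop} {r : P → ℝ} {i j : P}
    (hj : M i j) : (bestSet M r i).Nonempty := by
  classical
  obtain ⟨k, hk, hmax⟩ := Finset.exists_max_image (Finset.univ.filter fun j => M i j) r
    ⟨j, by simpa using hj⟩
  exact ⟨k, mem_bestSet.2 ⟨by simpa using hk, fun j' hj' => hmax j' (by simpa using hj')⟩⟩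

section Pick

variable {P : Type} [LinearOrder P] {M : P → P → Prop} {tie : TieBreak} {r : P → ℝ} {i j k : P}

theorem IsPick.unique (h : IsPick M tie r i j) (h' : IsPick M tie r i k) : j = k := by
  have h1 := h.2 k h'.1
  have h2 := h'.2 j h.1
  cases tie <;> simp only [TieBreak.prefers] at h1 h2 <;> grind

variable [Fintype P]

theorem isPick_min' (h : (bestSet M r i).Nonempty) :
    IsPick M .leftmost r i ((bestSet M r i).min' h) := by
  have hj := mem_bestSet.1 (Finset.min'_mem _ h)
  refine ⟨hj.1, fun j' hj' => (hj.2 j' hj').lt_or_eq.imp_right fun he => ⟨he, ?_⟩⟩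
  exact Finset.min'_le _ _ (mem_bestSet.2 ⟨hj', fun k hk => (hj.2 k hk).trans_eq he.symm⟩)

theorem isPick_max' (h : (bestSet M r i).Nonempty) :
    IsPick M .rightmost r i ((bestSet M r i).max' h) := by
  have hj := mem_bestSet.1 (Finset.max'_mem _ h)
  refine ⟨hj.1, fun j' hj' => (hj.2 j' hj').lt_or_eq.imp_right fun he => ⟨he, ?_⟩⟩
  exact Finset.le_max' _ _ (mem_bestSet.2 ⟨hj', fun k hk => (hj.2 k hk).trans_eq he.symm⟩)

theorem exists_isPick (hj : M i j) : ∃ k, IsPick M tie r i k := by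
  cases tie
  exacts [⟨_, isPick_min' (bestSet_nonempty hj)⟩, ⟨_, isPick_max' (bestSet_nonempty hj)⟩]

theorem UHead.attend_eq {ι : Type} [Fintype ι] (H : UHead ι) {u : P → ι → ℝ}
    (h : IsPick H.mask.allows H.tie (fun j => H.score (u i) (u j)) i j) :
    H.attend u i = H.V (u j) := by
  have hne : (H.maximizers H.mask.allows u i).Nonempty := bestSet_nonempty h.1
  rw [UHead.attend, dif_pos hne]
  rcases htie : H.tie with _ | _ <;> rw [htie] at h
  · exact congrArg (fun j => H.V (u j)) ((isPick_min' hne).unique h)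
  · exact congrArg (fun j => H.V (u j)) ((isPick_max' hne).unique h)

theorem UHead.attend_eq_zero {ι : Type} [Fintype ι] (H : UHead ι) {u : P → ι → ℝ}
    (h : ∀ j, ¬ H.mask.allows i j) : H.attend u i = 0 := by
  rw [UHead.attend, dif_neg]
  rintro ⟨j, hj⟩
  exact h j (mem_bestSet.1 hj).1

end Pick

section PickVal

variable {A : Type*} {q : ℕ → ℕ}

open Classical in
/-- The value of `s` at the leftmost (or rightmost) unmasked position where `ρ ∘ s` is maximal,
or `d` if every position is masked. -/
noncomputable def pickVal {R : Type*} (M : UMask) (tie : TieBreak) (ρ : R → ℝ) (d : R)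
    (s : Signal A q R) : Signal A q R :=
  fun c p => if h : ∃ j, IsPick M.allows tie (fun j => ρ (s c j)) p j then s c h.choose else d

variable {R : Type*} {M : UMask} {tie : TieBreak} {ρ : R → ℝ} {d : R} {s : Signal A q R}
  {c : Ctx A q}

theorem pickVal_eq {p j : Fin (c.n + 1)}
    (h : IsPick M.allows tie (fun j => ρ (s c j)) p j) : pickVal M tie ρ d s c p = s c j := by
  have h' : ∃ j, IsPick M.allows tie (fun j => ρ (s c j)) p j := ⟨j, h⟩
  rw [pickVal, dif_pos h', h'.choose_spec.unique h]

theorem pickVal_eq_default {p : Fin (c.n + 1)} (h : ∀ j, ¬ M.allows p j) :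
    pickVal M tie ρ d s c p = d := by
  rw [pickVal, dif_neg]
  rintro ⟨j, hj⟩
  exact h j hj.1

/-- The masks that unique-hard and average-hard attention have in common. -/
def AMask.toUMask : AMask → UMask
  | .none => .none
  | .strictFuture => .strictFuture
  | .future => .future

theorem AMask.toUMask_allows {P : Type} [LinearOrder P] (m : AMask) :
    m.toUMask.allows (P := P) = m.allows := by
  cases m <;> rfl

/-- Finitely many real numbers can be scaled so that distinct ones are far apart. -/
theorem exists_scale_gap (ρ : R → ℝ) (X : Finset R) :
    ∃ C : ℝ, ∀ x ∈ X, ∀ y ∈ X, ρ x < ρ y → C * ρ x + 3 ≤ C * ρ y := by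
  have h : ∀ x ∈ X, ∀ y ∈ X, ∀ᶠ C : ℝ in Filter.atTop, ρ x < ρ y → C * ρ x + 3 ≤ C * ρ y := by
    intro x _ y _
    filter_upwards [Filter.eventually_ge_atTop (3 / (ρ y - ρ x))] with C hC hlt
    have := (div_le_iff₀ (sub_pos.2 hlt)).1 hC
    linarith
  have h' : ∀ᶠ C : ℝ in Filter.atTop, ∀ x ∈ X, ∀ y ∈ X, ρ x < ρ y → C * ρ x + 3 ≤ C * ρ y := by
    rw [Filter.eventually_all_finset]
    intro x hx
    rw [Filter.eventually_all_finset]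
    exact h x hx
  exact h'.exists

theorem posSig_lt {p p' : Fin (c.n + 1)} (h : p < p') : posSig c p < posSig c p' := by
  have : (p : ℝ) < p' := by exact_mod_cast h
  exact div_lt_div_of_pos_right (by linarith) c.n_pos

/-- The mask on the reversed sequence. -/
def UMask.flip : UMask → UMask
  | .none => .none
  | .strictFuture => .strictPast
  | .future => .past
  | .strictPast => .strictFuture
  | .past => .future

/-- The choice function on the reversed sequence. -/
def TieBreak.flip : TieBreak → TieBreak
  | .leftmost => .rightmost
  | .rightmost => .leftmost

theorem UMask.flip_allows_rev {n : ℕ} (M : UMask) {i k : Fin n} :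
    M.flip.allows i.rev k ↔ M.allows i k.rev := by
  cases M <;> simp [UMask.flip, UMask.allows, Fin.lt_rev_iff, Fin.rev_lt_iff, Fin.le_rev_iff,
    Fin.rev_le_iff]

theorem isPick_flip {n : ℕ} {r : Fin n → ℝ} {i j : Fin n} (h : IsPick M.allows tie r i j) :
    IsPick M.flip.allows tie.flip (fun j => r j.rev) i.rev j.rev := by
  have hM : ∀ k : Fin n, M.flip.allows i.rev k ↔ M.allows i k.rev := fun _ => M.flip_allows_rev
  have ht : ∀ k : Fin n, tie.flip.prefers j.rev k ↔ tie.prefers j k.rev := by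
    intro k
    cases tie <;> simp [TieBreak.flip, TieBreak.prefers, Fin.le_rev_iff, Fin.rev_le_iff]
  refine ⟨by simpa [hM] using h.1, fun k hk => ?_⟩
  simpa [ht] using h.2 k.rev ((hM k).1 hk)

theorem pickVal_flip (p : Fin (c.n + 1)) :
    pickVal M.flip tie.flip ρ d (fun c p => s c p.rev) c p.rev = pickVal M tie ρ d s c p := by
  by_cases hp : ∃ j, M.allows p j
  · obtain ⟨j, hj⟩ := hp
    obtain ⟨k, hk⟩ := exists_isPick (tie := tie) (r := fun j => ρ (s c j)) hj
    rw [pickVal_eq hk, pickVal_eq (isPick_flip hk), Fin.rev_rev]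
  · push Not at hp
    rw [pickVal_eq_default hp, pickVal_eq_default]
    intro j hj
    refine hp j.rev ?_
    exact M.flip_allows_rev.1 hj

/-- Ties are broken by adding the position encoding, with the appropriate sign, to the scaled
scores: it is unique to each position and too small to affect the comparison of distinct
scores. -/
theorem finComp_pickVal_aMask (m : AMask) (tie : TieBreak) (ρ : R → ℝ) (d : R)
    (hs : FinComp s) : FinComp (pickVal m.toUMask tie ρ d s) := by
  classical
  obtain ⟨X, hX⟩ := hs.exists_range
  obtain ⟨C, hC⟩ := exists_scale_gap ρ X
  let σ : ℝ := match tie with | .leftmost => -1 | .rightmost => 1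
  have hkey : Comp fun c p => C * ρ (s c p) + σ * posSig c p + 0 :=
    (hs.real ρ).affine comp_posSig C σ 0
  refine .of_ne (insert d X) (fun c p => ?_) d fun x hx => ?_
  · rw [pickVal]
    split_ifs with h
    · exact Finset.mem_insert_of_mem (hX _ _)
    · exact Finset.mem_insert_self _ _
  · refine (comp_attn m (m := 1) (Q := fun _ _ _ => 1) (fun _ => comp_const 1)
      (fun _ => hkey) (hs.compP x)).congr fun c p => ?_
    by_cases hp : ∃ j, m.allows p j
    · obtain ⟨j, hj⟩ := hp
      obtain ⟨k, hk⟩ := exists_isPick (tie := tie) (r := fun j => ρ (s c j))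
        (M := m.toUMask.allows) (i := p) (j := j) (by rwa [m.toUMask_allows])
      simp only [pickVal_eq hk]
      rw [m.toUMask_allows] at hk
      refine attn_eq_of_unique k hk.1 fun j' hj' hne => ?_
      simp only [Finset.univ_unique, Finset.sum_singleton, one_mul, add_zero]
      have hj1 := abs_le.1 (show |posSig c j'| ≤ 1 from abs_inputValue_pos_le c j')
      have hk1 := abs_le.1 (show |posSig c k| ≤ 1 from abs_inputValue_pos_le c k)
      rcases hk.2 j' hj' with hlt | ⟨heq, hpref⟩
      · have := hC _ (hX c j') _ (hX c k) hlt
        rcases tie <;> simp only [σ] <;> linarith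
      · simp only [heq, add_lt_add_iff_left]
        rcases tie
        · have := posSig_lt (lt_of_le_of_ne hpref hne.symm)
          simp only [σ]
          linarith
        · have := posSig_lt (lt_of_le_of_ne hpref hne)
          simp only [σ]
          linarith
    · push Not at hp
      have hp' : ∀ j, ¬ m.toUMask.allows p j := by rwa [m.toUMask_allows]
      simp only [pickVal_eq_default hp', if_neg hx.symm, attn_eq_zero hp]

/-- Past masks become future masks on the reversed sequence. -/
theorem finComp_pickVal (M : UMask) (tie : TieBreak) (ρ : R → ℝ) (d : R) (hs : FinComp s) :
    FinComp (pickVal M tie ρ d s) := by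
  have hflip : ∀ m : AMask, m.toUMask = M.flip → FinComp (pickVal M tie ρ d s) := by
    intro m hm
    have h := (finComp_pickVal_aMask m tie.flip ρ d hs.rev).rev
    rw [hm] at h
    exact h.congr fun c p => pickVal_flip p
  cases M with
  | none => exact finComp_pickVal_aMask .none tie ρ d hs
  | strictFuture => exact finComp_pickVal_aMask .strictFuture tie ρ d hs
  | future => exact finComp_pickVal_aMask .future tie ρ d hs
  | strictPast => exact hflip .strictFuture rfl
  | past => exact hflip .future rfl

end PickVal

/-! ### Simulation of unique-hard attention layers -/

section Simulation

variable {A : Type*} {q : ℕ → ℕ}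

/-- The element of `Fin (n + 1)` that represents the position `i` of the input string. -/
def realPos {l n : ℕ} (h : l < n) (i : Fin l) : Fin (n + 1) :=
  ⟨i + 1, by omega⟩

theorem realPos_strictMono {l n : ℕ} (h : l < n) : StrictMono (realPos h) := by
  intro i j hij
  exact Nat.succ_lt_succ hij

/-- A sequence over the positions of the input string, extended by `none` to the default position
and to the padding. -/
noncomputable def pad {R : Type*} (u : (c : Ctx A q) → Fin c.word.length → R) :
    Signal A q (Option R) :=
  fun c => Function.extend (realPos c.length_lt) (fun i => some (u c i)) fun _ => none

theorem pad_realPos {R : Type*} (u : (c : Ctx A q) → Fin c.word.length → R) (c : Ctx A q)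
    (i : Fin c.word.length) : pad u c (realPos c.length_lt i) = some (u c i) :=
  (realPos_strictMono _).injective.extend_apply _ _ _

theorem pad_of_not_real {R : Type*} (u : (c : Ctx A q) → Fin c.word.length → R) (c : Ctx A q)
    {p : Fin (c.n + 1)} (hp : ¬ ∃ i, realPos c.length_lt i = p) : pad u c p = none :=
  Function.extend_apply' _ _ _ hp

theorem pad_zero {R : Type*} (u : (c : Ctx A q) → Fin c.word.length → R) (c : Ctx A q) :
    pad u c 0 = none :=
  pad_of_not_real u c fun ⟨i, hi⟩ => by simp [realPos, Fin.ext_iff] at hi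

theorem pad_map {R S : Type*} (u : (c : Ctx A q) → Fin c.word.length → R) (f : R → S)
    (c : Ctx A q) (p : Fin (c.n + 1)) : pad (fun c i => f (u c i)) c p = (pad u c p).map f := by
  by_cases hp : ∃ i, realPos c.length_lt i = p
  · obtain ⟨i, rfl⟩ := hp
    simp only [pad_realPos, Option.map_some]
  · simp only [pad_of_not_real _ c hp, Option.map_none]

theorem UMask.allows_strictMono {P P' : Type} [LinearOrder P] [LinearOrder P'] {f : P → P'}
    (hf : StrictMono f) (M : UMask) {i j : P} : M.allows (f i) (f j) ↔ M.allows i j := by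
  cases M <;> simp [UMask.allows, hf.lt_iff_lt, hf.le_iff_le]

/-- Selection among the positions of the input string is not affected by the additional positions
if these have lower scores. -/
theorem isPick_realPos {l n : ℕ} (h : l < n) {M : UMask} {tie : TieBreak} {r : Fin l → ℝ}
    {r' : Fin (n + 1) → ℝ} {i j : Fin l} (hr : ∀ k, r' (realPos h k) = r k)
    (hlow : ∀ p, (¬ ∃ k, realPos h k = p) → ∀ k, r' p < r k) (hj : IsPick M.allows tie r i j) :
    IsPick M.allows tie r' (realPos h i) (realPos h j) := by
  have hM : ∀ k, M.allows (realPos h i) (realPos h k) ↔ M.allows i k := fun k =>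
    M.allows_strictMono (realPos_strictMono h)
  have ht : ∀ k, tie.prefers (realPos h j) (realPos h k) ↔ tie.prefers j k := by
    intro k
    cases tie <;> simp [TieBreak.prefers, (realPos_strictMono h).le_iff_le]
  refine ⟨(hM j).2 hj.1, fun p hp => ?_⟩
  by_cases hk : ∃ k, realPos h k = p
  · obtain ⟨k, rfl⟩ := hk
    rw [hr, hr, ht]
    exact hj.2 k ((hM k).1 hp)
  · left
    rw [hr]
    exact hlow p hk j

variable {ι : Type} [Fintype ι]

theorem FinComp.pad_map₂ {R S W : Type*} {u : (c : Ctx A q) → Fin c.word.length → R}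
    {v : (c : Ctx A q) → Fin c.word.length → S} (hu : FinComp (pad u)) (hv : FinComp (pad v))
    (f : R → S → W) : FinComp (pad fun c i => f (u c i) (v c i)) := by
  refine (hu.map₂ hv (Option.map₂ f)).congr fun c p => ?_
  by_cases hp : ∃ i, realPos c.length_lt i = p
  · obtain ⟨i, rfl⟩ := hp
    simp only [pad_realPos, Option.map₂_some_some]
  · simp only [pad_of_not_real _ c hp, Option.map₂_none_left]

/-- For every possible activation vector `x` at the querying position, the head selects a
position by a fixed ranking of the finitely many activation vectors. -/
theorem finComp_attend (H : UHead ι) {U : (c : Ctx A q) → Fin c.word.length → ι → ℝ}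
    (hU : FinComp (pad U)) : FinComp (pad fun c => H.attend (U c)) := by
  classical
  obtain ⟨X, hX⟩ := hU.exists_range
  have hlow : ∀ x : ι → ℝ, ∃ b : ℝ, ∀ o ∈ X, ∀ y, o = some y → b < H.score x y := by
    intro x
    have h : ∀ᶠ b : ℝ in Filter.atBot, ∀ o ∈ X, ∀ y, o = some y → b < H.score x y := by
      rw [Filter.eventually_all_finset]
      rintro (_ | y) _
      · simp
      · filter_upwards [Filter.eventually_lt_atBot (H.score x y)] with b hb y' hy'
        rwa [← Option.some_injective _ hy']
    exact h.exists
  choose b hb using hlow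
  -- positions outside of the input string rank below those inside
  let ρ : (ι → ℝ) → Option (ι → ℝ) → ℝ := fun x o => o.elim (b x) (H.score x)
  let t : Option (ι → ℝ) → Signal A q (Option (ι → ℝ))
    | none => fun _ _ => none
    | some x => fun c p => some ((pickVal H.mask H.tie (ρ x) none (pad U) c p).elim 0 H.V)
  have ht : ∀ o, FinComp (t o) := by
    rintro (_ | x)
    · exact FinComp.const none
    · exact (finComp_pickVal H.mask H.tie (ρ x) none hU).map fun o => some (o.elim 0 H.V)
  refine (hU.bind ht).congr fun c p => ?_
  by_cases hp : ∃ i, realPos c.length_lt i = p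
  · obtain ⟨i, rfl⟩ := hp
    rw [pad_realPos, pad_realPos]
    simp only [t, Option.some_inj]
    by_cases hi : ∃ j, H.mask.allows i j
    · obtain ⟨j, hj⟩ := hi
      obtain ⟨k, hk⟩ := exists_isPick (tie := H.tie) (r := fun j => H.score (U c i) (U c j)) hj
      rw [H.attend_eq hk, pickVal_eq (isPick_realPos c.length_lt ?_ ?_ hk), pad_realPos]
      · rfl
      · intro k; simp only [pad_realPos, ρ, Option.elim_some]
      · intro p' hp' k
        simp only [pad_of_not_real U c hp', ρ, Option.elim_none]
        exact hb _ _ (hX c (realPos c.length_lt k)) _ (pad_realPos U c k)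
    · push Not at hi
      rw [H.attend_eq_zero hi, pickVal]
      split_ifs with h
      · rw [pad_of_not_real]
        · rfl
        · rintro ⟨j, hj⟩
          have := h.choose_spec.1
          rw [← hj, H.mask.allows_strictMono (realPos_strictMono _)] at this
          exact hi j this
      · rfl
  · rw [pad_of_not_real _ c hp, pad_of_not_real _ c hp]

theorem finComp_layer (L : ULayer ι) {U : (c : Ctx A q) → Fin c.word.length → ι → ℝ}
    (hU : FinComp (pad U)) : FinComp (pad fun c => L.apply (U c)) := by
  cases L with
  | positionwise F =>
    exact (hU.map (Option.map fun x => x + F.eval x)).congr fun c p => (pad_map U _ c p).symm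
  | attention heads =>
    have h : FinComp (pad fun c i => (heads.map fun H => H.attend (U c) i).sum) := by
      induction heads with
      | nil =>
        exact (hU.map (Option.map fun _ => 0)).congr fun c p => (pad_map U _ c p).symm
      | cons H heads ih => exact ((finComp_attend H hU).pad_map₂ ih (· + ·))
    exact hU.pad_map₂ h (· + ·)

theorem finComp_layers (Ls : List (ULayer ι)) {U : (c : Ctx A q) → Fin c.word.length → ι → ℝ}
    (hU : FinComp (pad U)) :
    FinComp (pad fun c => Ls.foldl (fun u L => L.apply u) (U c)) := by
  induction Ls generalizing U with
  | nil => exact hU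
  | cons L Ls ih => exact ih (finComp_layer L hU)

theorem finComp_word [Finite A] : FinComp (pad fun (c : Ctx A q) i => c.word.get i) := by
  classical
  have := Fintype.ofFinite A
  refine .of_ne Finset.univ (fun _ _ => Finset.mem_univ _) none fun x hx => ?_
  obtain ⟨a, rfl⟩ := Option.ne_none_iff_exists'.1 hx
  refine (comp_input (x := .sym (some a))).congr fun c p => ?_
  simp only [inputValue, oneHot]
  cases p using Fin.cases with
  | zero =>
    simp [pad_zero]
  | succ i =>
    rw [Fin.cases_succ]
    by_cases hi : (i : ℕ) < c.word.length
    · have : i.succ = realPos c.length_lt ⟨i, hi⟩ := rfl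
      simp [this, pad_realPos, hi]
    · have h0 : ¬ ∃ j, realPos c.length_lt j = i.succ := by
        rintro ⟨j, hj⟩
        have := j.2
        simp only [realPos, Fin.ext_iff, Fin.val_succ] at hj
        omega
      simp [pad_of_not_real _ c h0, List.getElem?_eq_none (not_lt.1 hi)]

end Simulation

/-! ### Concatenation of the output strings -/

/-- The end, in the concatenation of the strings `g j`, of the block with index `p`. -/
def blockEnd {B : Type*} {N : ℕ} (g : Fin N → List B) (p : Fin N) : ℕ :=
  ∑ j ∈ Finset.Iic p, (g j).length

section Blocks

variable {B : Type*} {N : ℕ}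

theorem length_le_blockEnd (g : Fin N → List B) (p : Fin N) : (g p).length ≤ blockEnd g p :=
  Finset.single_le_sum (f := fun j => (g j).length) (fun _ _ => Nat.zero_le _) (by simp)

theorem blockEnd_add_le (g : Fin N → List B) {p p' : Fin N} (h : p < p') :
    blockEnd g p + (g p').length ≤ blockEnd g p' := by
  rw [blockEnd, blockEnd, add_comm, ← Finset.sum_insert (f := fun j => (g j).length) (by simpa)]
  refine Finset.sum_le_sum_of_subset fun j hj => ?_
  simp only [Finset.mem_insert, Finset.mem_Iic] at hj ⊢
  rcases hj with rfl | hj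
  exacts [le_rfl, hj.trans h.le]

theorem blockEnd_le_length (g : Fin N → List B) (p : Fin N) :
    blockEnd g p ≤ (List.ofFn g).flatten.length := by
  have : (List.ofFn g).flatten.length = ∑ j, (g j).length := by
    rw [List.length_flatten, List.map_ofFn, List.sum_ofFn]
    rfl
  rw [this]
  exact Finset.sum_le_sum_of_subset (Finset.subset_univ _)

theorem blockEnd_zero (g : Fin (N + 1) → List B) : blockEnd g 0 = (g 0).length := by
  have : Finset.Iic (0 : Fin (N + 1)) = {0} := by ext j; simp
  simp [blockEnd, this]

theorem blockEnd_succ (g : Fin (N + 1) → List B) (p : Fin N) :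
    blockEnd g p.succ = (g 0).length + blockEnd (fun j => g j.succ) p := by
  simp only [blockEnd, Finset.sum_filter, ← Finset.filter_ge_eq_Iic]
  rw [Fin.sum_univ_succ]
  simp

/-- The symbol at index `i` of the concatenation is the `r`-th symbol from the end of the block
that ends at `r + i`. -/
theorem getElem?_flatten_ofFn (g : Fin N → List B) (i : ℕ) (b : B) :
    (List.ofFn g).flatten[i]? = some b ↔
      ∃ r j, 1 ≤ r ∧ r ≤ (g j).length ∧ blockEnd g j = r + i ∧
        (g j)[(g j).length - r]? = some b := by
  induction N generalizing i with
  | zero => simp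
  | succ N ih =>
    rw [List.ofFn_succ, List.flatten_cons, List.getElem?_append]
    simp only [Fin.exists_fin_succ, blockEnd_zero, blockEnd_succ, exists_or]
    split_ifs with hi
    · constructor
      · intro h
        refine Or.inl ⟨(g 0).length - i, by omega, by omega, by omega, ?_⟩
        rwa [Nat.sub_sub_self hi.le]
      · rintro (⟨r, h1, h2, h3, h4⟩ | ⟨r, j, h1, h2, h3, -⟩)
        · rwa [show (g 0).length - r = i by omega] at h4
        · have : (g j.succ).length ≤ _ := length_le_blockEnd (fun j => g j.succ) j
          omega
    · rw [ih]
      constructor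
      · rintro ⟨r, j, h1, h2, h3, h4⟩
        exact Or.inr ⟨r, j, h1, h2, by omega, h4⟩
      · rintro (⟨r, h1, h2, h3, h4⟩ | ⟨r, j, h1, h2, h3, h4⟩)
        · omega
        · exact ⟨r, j, h1, h2, by omega, h4⟩

theorem flatten_ofFn_extend {l n : ℕ} (hl : l ≤ n) {g : Fin l → List B} {h : Fin n → List B}
    (h1 : ∀ i, h (Fin.castLE hl i) = g i) (h2 : ∀ i : Fin n, l ≤ (i : ℕ) → h i = []) :
    (List.ofFn h).flatten = (List.ofFn g).flatten := by
  induction l generalizing n with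
  | zero =>
    have : ∀ i, h i = [] := fun i => h2 i (Nat.zero_le _)
    simp [this]
  | succ l ih =>
    obtain ⟨n, rfl⟩ := Nat.exists_eq_succ_of_ne_zero (by omega : n ≠ 0)
    rw [List.ofFn_succ, List.ofFn_succ, List.flatten_cons, List.flatten_cons,
      ih (Nat.le_of_succ_le_succ hl) (fun i => h1 i.succ)
        (fun i hi => h2 i.succ (Nat.succ_le_succ hi))]
    exact congrArg (· ++ _) (h1 0)

end Blocks

theorem indicator_congr {P Q : Prop} {_ : Decidable P} {_ : Decidable Q} (h : P ↔ Q) :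
    (if P then (1 : ℝ) else 0) = if Q then 1 else 0 :=
  if_congr h rfl rfl

theorem oneHot_eq {α : Type*} {n : ℕ} (w : List α) (p : Fin (n + 1)) (s : Option α) :
    oneHot w p s = open Classical in if p ≠ 0 ∧ w[(p : ℕ) - 1]? = s then 1 else 0 := by
  cases p using Fin.cases with
  | zero => simp [oneHot]
  | succ i =>
    rw [oneHot, Fin.cases_succ]
    exact indicator_congr (by simp [Fin.succ_ne_zero])


/-! ### Writing the output -/

section Output

variable {A : Type*} {q : ℕ → ℕ} {B : Type*} {o : Signal A q (List B)}

theorem flatten_ofFn_pad {R : Type*} (u : (c : Ctx A q) → Fin c.word.length → R)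
    (g : R → List B) (c : Ctx A q) :
    (List.ofFn fun p => (pad u c p).elim [] g).flatten =
      (List.ofFn fun i => g (u c i)).flatten := by
  rw [List.ofFn_succ, List.flatten_cons, pad_zero, Option.elim_none, List.nil_append]
  refine flatten_ofFn_extend c.length_lt.le (fun i => ?_) fun i hi => ?_
  · have : (Fin.castLE c.length_lt.le i).succ = realPos c.length_lt i := rfl
    rw [this, pad_realPos, Option.elim_some]
  · rw [pad_of_not_real, Option.elim_none]
    rintro ⟨j, hj⟩
    have := j.2
    simp only [realPos, Fin.ext_iff, Fin.val_succ] at hj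
    omega

/-- The `r`-th symbol from the end of some block belongs at position `p` of the output, and it
is `b`. The index `p` stands for the position `p - 1`. -/
def Hit (o : Signal A q (List B)) (r : ℕ) (b : B) : Signal A q Prop :=
  fun c p => ∃ j, r ≤ (o c j).length ∧ blockEnd (o c) j + 1 = r + p ∧
    (o c j)[(o c j).length - r]? = some b

theorem sum_weights (c : Ctx A q) (r : ℕ) (p : Fin (c.n + 1)) :
    ∑ j ∈ Finset.Iic p, (((o c j).length : ℝ) * (1 / c.n) +
      if j = 0 then (-(r : ℝ)) * (1 / c.n) else 0) = (blockEnd (o c) p - r) / c.n := by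
  rw [Finset.sum_add_distrib, ← Finset.sum_mul, Finset.sum_ite_eq' , blockEnd]
  simp only [Finset.mem_Iic, Fin.zero_le, if_true]
  push_cast
  ring

/-- This is the average, over the positions up to `p`, of the weights `|o j| / n`, with `-r / n`
added at the default position. -/
theorem comp_target (ho : FinComp o) (r : ℕ) :
    Comp fun c p => (blockEnd (o c) p - r) / c.n * (1 / ((p : ℝ) - 1 + 2)) := by
  classical
  have hv : Comp fun c j => ((o c j).length : ℝ) * (1 / c.n) +
      if j = 0 then (-(r : ℝ)) * (1 / c.n) else 0 :=
    (ho.select (v := fun x c _ => (x.length : ℝ) * (1 / c.n)) fun x =>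
      comp_inv.const_mul _).add (((comp_inv.const_mul (-(r : ℝ))).ite compP_default).congr
        fun c p => by congr)
  refine (comp_attn .future (m := 0) (Q := Fin.elim0) (K := Fin.elim0) (fun s => s.elim0)
    (fun s => s.elim0) hv).congr fun c p => ?_
  have hb : bestSet AMask.future.allows
      (fun j => ∑ s : Fin 0, (Fin.elim0 s : Signal A q ℝ) c p * (Fin.elim0 s : Signal A q ℝ) c j) p
      = Finset.Iic p := by
    ext j
    simp [mem_bestSet, AMask.allows]
  rw [attn, hb, sum_weights c, Fin.card_Iic]
  push_cast
  rw [show (p : ℝ) - 1 + 2 = p + 1 by ring]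
  ring

/-- Attention fetches the value of `v` at the position of index `blockEnd j - r`, provided that
there is one: with `y = (blockEnd j - r) / n`, it is where `2 x y - x ^ 2` is maximal. The average
of `comp_target` is `y` only up to the factor `1 / (j + 2)`, but the whole score can be scaled by
this factor, which is part of the position encoding. -/
theorem exists_lookup (ho : FinComp o) (r : ℕ) {v : Signal A q ℝ}
    (hv : Comp v) : ∃ g : Signal A q ℝ, Comp g ∧ ∀ c (p t : Fin (c.n + 1)),
      (t : ℝ) - 1 = blockEnd (o c) p - r → g c p = v c t := by
  refine ⟨attn .none (m := 2)
    ![fun c p => (blockEnd (o c) p - r) / c.n * (1 / ((p : ℝ) - 1 + 2)),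
      fun c p => inputValue c.word p .posi]
    ![fun c p => 2 * posSig c p, fun c p => (-1) * inputValue c.word p .posq] v,
    comp_attn _ ?_ ?_ hv, fun c p t ht => ?_⟩
  · exact Fin.forall_fin_two.2 ⟨comp_target ho r, comp_input (x := .posi)⟩
  · exact Fin.forall_fin_two.2 ⟨comp_posSig.const_mul 2, comp_input.const_mul (-1)⟩
  · refine attn_eq_of_unique t trivial fun j _ hj => ?_
    simp only [Fin.sum_univ_two, Matrix.cons_val_zero, Matrix.cons_val_one, posSig, inputValue]
    rw [← ht]
    have hn := c.n_pos
    have hne : ((t : ℝ) - 1) / c.n - ((j : ℝ) - 1) / c.n ≠ 0 := by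
      rw [← sub_div, div_ne_zero_iff]
      refine ⟨fun h => hj (Fin.ext ?_), hn.ne'⟩
      have : (j : ℝ) = t := by linarith
      exact_mod_cast this
    have h1 := pow_pos (abs_pos.2 hne) 2
    rw [sq_abs] at h1
    have h2 : 0 < 1 / ((p : ℝ) - 1 + 2) := by
      have : (0 : ℝ) ≤ p := by positivity
      apply one_div_pos.2; linarith
    nlinarith [mul_pos h1 h2]

/-- A block `j` of length at least `r` has looked up `X = (blockEnd j - r) / n` and `X ^ 2`, where
`blockEnd j - r` is the index of its `r`-th symbol from the end. For the query value `x = i / n`,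
its score is `2 x X - X ^ 2 = x ^ 2 - (x - X) ^ 2`. The default position competes with the score
`x ^ 2 - (1 / (2 n)) ^ 2`, so that it is selected unless `X = x` for some block; all other
positions get the score `-1`. -/
theorem compP_hit (ho : FinComp o) (h0 : ∀ c, o c 0 = [])
    (hlt : ∀ c, (List.ofFn (o c)).flatten.length < c.n) {r : ℕ} (hr : 1 ≤ r) (b : B) :
    CompP (Hit o r b) := by
  classical
  obtain ⟨X, hX, hX'⟩ := exists_lookup ho r comp_posSig
  obtain ⟨Y, hY, hY'⟩ := exists_lookup ho r (comp_input (x := .posq))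
  have hvalid : CompP fun c j => r ≤ (o c j).length := ho.compP_pred fun x => r ≤ x.length
  have hinvalid : CompP fun c j => ¬ r ≤ (o c j).length ∧ ¬ j = 0 :=
    hvalid.not.and compP_default.not
  have hval : CompP fun c j => (o c j)[(o c j).length - r]? = some b :=
    ho.compP_pred fun x => x[x.length - r]? = some b
  have hd : Comp (A := A) (q := q) fun c _ => inputValue (n := c.n) c.word 0 .posq :=
    comp_input.at_default
  refine (comp_attn .none (m := 3)
    (Q := ![posSig, fun _ _ => 1, fun c p => 1 * inputValue c.word p .posq +
      (-1 / 4) * inputValue (n := c.n) c.word 0 .posq + 0])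
    (K := ![fun c j => 2 * (if r ≤ (o c j).length then X c j else 0),
      fun c j => (-1) * (if r ≤ (o c j).length then Y c j else 0) +
        (-1) * (if ¬ r ≤ (o c j).length ∧ ¬ j = 0 then 1 else 0) + 0,
      fun c j => if j = 0 then 1 else 0]) ?_ ?_ hval).congr fun c p => ?_
  · rw [Fin.forall_fin_succ, Fin.forall_fin_two]
    exact ⟨comp_posSig, comp_const 1, comp_input.affine hd _ _ _⟩
  · rw [Fin.forall_fin_succ, Fin.forall_fin_two]
    have h1 := (hX.ite hvalid).const_mul 2
    have h2 := (hY.ite hvalid).affine hinvalid (-1) (-1) 0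
    have h3 := compP_default (A := A) (q := q)
    refine ⟨h1.congr fun c p => ?_, h2.congr fun c p => ?_, Comp.congr h3 fun c p => ?_⟩ <;> congr
  have hn := c.n_pos
  have hn1 : (1 : ℝ) ≤ c.n := by exact_mod_cast Nat.one_le_of_lt c.length_lt
  set x : ℝ := ((p : ℝ) - 1) / c.n with hx
  obtain ⟨score, hscore⟩ : ∃ score : Fin (c.n + 1) → ℝ, score = fun j =>
      x * (2 * (if r ≤ (o c j).length then X c j else 0)) +
        ((-1) * (if r ≤ (o c j).length then Y c j else 0) +
        (-1) * (if ¬ r ≤ (o c j).length ∧ ¬ j = 0 then 1 else 0)) +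
        (x ^ 2 - 1 / 4 * (1 / c.n) ^ 2) * (if j = 0 then 1 else 0) := ⟨_, rfl⟩
  have hscore_default : score 0 = x ^ 2 - 1 / 4 * (1 / c.n) ^ 2 := by
    simp [hscore, h0, show r ≠ 0 by omega]
  have hscore_invalid : ∀ j, ¬ r ≤ (o c j).length → j ≠ 0 → score j = -1 := by
    intro j hj hj0
    simp [hscore, hj0, hj]
  have hscore_valid : ∀ j, r ≤ (o c j).length →
      score j = x ^ 2 - ((p : ℝ) - 1 - (blockEnd (o c) j - r)) ^ 2 * (1 / c.n) ^ 2 := by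
    intro j hj
    have hj0 : j ≠ 0 := by
      rintro rfl
      simp [h0] at hj
      omega
    have hE1 := length_le_blockEnd (o c) j
    have hE2 := (blockEnd_le_length (o c) j).trans_lt (hlt c)
    -- the symbol is placed inside the output since the vector length exceeds that of the output
    have ht : (((⟨blockEnd (o c) j - r + 1, by omega⟩ : Fin (c.n + 1)) : ℕ) : ℝ) - 1 =
        blockEnd (o c) j - r := by
      push_cast [Nat.cast_sub (hj.trans hE1)]
      ring
    simp only [hscore, hj, hj0, if_true, if_false, hX' c j _ ht, hY' c j _ ht, posSig, inputValue,
      ht, not_true, false_and]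
    rw [hx]
    ring
  have hsum : ∀ j, (∑ s : Fin 3, (![posSig, fun _ _ => 1, fun c p =>
      1 * inputValue c.word p .posq +
      (-1 / 4) * inputValue (n := c.n) c.word 0 .posq + 0] : Fin 3 → Signal A q ℝ) s c p *
    (![fun c j => 2 * (if r ≤ (o c j).length then X c j else 0),
      fun c j => (-1) * (if r ≤ (o c j).length then Y c j else 0) +
        (-1) * (if ¬ r ≤ (o c j).length ∧ ¬ j = 0 then 1 else 0) + 0,
      fun c j => if j = 0 then 1 else 0] : Fin 3 → Signal A q ℝ) s c j) = score j := by
    intro j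
    rw [Fin.sum_univ_three, hscore]
    simp only [Matrix.cons_val_zero, Matrix.cons_val_one, Matrix.cons_val, posSig, inputValue,
      Fin.val_zero, Nat.cast_zero, ← hx]
    ring
  have hn2 : (0 : ℝ) < (1 / c.n) ^ 2 := by positivity
  have hn3 : (1 / c.n : ℝ) ^ 2 ≤ 1 := pow_le_one₀ (by positivity) ((div_le_one hn).2 hn1)
  -- distinct indices are at distance at least one
  have hdist : ∀ j, blockEnd (o c) j + 1 ≠ r + p →
      1 ≤ ((p : ℝ) - 1 - (blockEnd (o c) j - r)) ^ 2 := by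
    intro j hj
    have h : (1 : ℤ) ≤ ((p : ℤ) - 1 - (blockEnd (o c) j - r)) ^ 2 := by
      have : ((p : ℤ) - 1 - (blockEnd (o c) j - r)) ≠ 0 := by omega
      have := sq_pos_of_ne_zero this
      omega
    exact_mod_cast h
  have hx2 := sq_nonneg x
  by_cases hm : ∃ j, r ≤ (o c j).length ∧ blockEnd (o c) j + 1 = r + p
  · obtain ⟨j, hj, hjp⟩ := hm
    have huniq : ∀ k, r ≤ (o c k).length → blockEnd (o c) k + 1 = r + p → k = j := by
      intro k hk hkp
      rcases lt_trichotomy k j with h | h | h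
      · have := blockEnd_add_le (o c) h
        omega
      · exact h
      · have := blockEnd_add_le (o c) h
        omega
    have hsj : score j = x ^ 2 := by
      have hjp' : (blockEnd (o c) j : ℝ) + 1 = r + p := by exact_mod_cast hjp
      rw [hscore_valid j hj, show (p : ℝ) - 1 - (blockEnd (o c) j - r) = 0 by linarith]
      ring
    rw [attn_eq_of_unique (mask := .none) j trivial]
    · refine indicator_congr ⟨fun h => ⟨j, hj, hjp, h⟩, ?_⟩
      rintro ⟨k, hk, hkp, h⟩
      rwa [← huniq k hk hkp]
    · intro k _ hkj
      rw [hsum, hsum, hsj]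
      by_cases hk : r ≤ (o c k).length
      · have := hdist k fun h => hkj (huniq k hk h)
        rw [hscore_valid k hk]
        nlinarith
      · by_cases hk0 : k = 0
        · rw [hk0, hscore_default]
          linarith
        · rw [hscore_invalid k hk hk0]
          linarith
  · push Not at hm
    rw [attn_eq_of_unique (mask := .none) 0 trivial]
    · rw [if_neg (by simp [h0]), if_neg]
      rintro ⟨k, hk, hkp, -⟩
      exact hm k hk hkp
    · intro k _ hk0
      rw [hsum, hsum, hscore_default]
      by_cases hk : r ≤ (o c k).length
      · have := hdist k (hm k hk)
        rw [hscore_valid k hk]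
        nlinarith
      · rw [hscore_invalid k hk hk0]
        linarith

/-- The number of values of `r` to be tried is finite since the lengths of the blocks are
bounded. -/
theorem comp_oneHot_flatten [Finite B] (ho : FinComp o) (h0 : ∀ c, o c 0 = [])
    (hlt : ∀ c, (List.ofFn (o c)).flatten.length < c.n) (t : Option B) :
    Comp fun c p => oneHot (List.ofFn (o c)).flatten p t := by
  classical
  have := Fintype.ofFinite B
  obtain ⟨X, hX⟩ := ho.exists_range
  have hsome : ∀ b, CompP fun c p =>
      p ≠ 0 ∧ (List.ofFn (o c)).flatten[(p : ℕ) - 1]? = some b := by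
    intro b
    have h : ∀ r, CompP fun c p => 1 ≤ r ∧ Hit o r b c p := by
      intro r
      by_cases hr : 1 ≤ r
      · exact (compP_hit ho h0 hlt hr b).congr fun c p => by simp [hr]
      · exact (compP_const False).congr fun c p => by simp [hr]
    refine (CompP.exists_mem (Finset.range (X.sup List.length + 1)) h).congr fun c p => ?_
    rw [getElem?_flatten_ofFn]
    simp only [Finset.mem_range, Hit]
    constructor
    · rintro ⟨r, -, h1, j, h2, h3, h4⟩
      have hp : p ≠ 0 := by
        rintro rfl
        have := length_le_blockEnd (o c) j
        simp only [Fin.val_zero] at h3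
        omega
      have hp' : (p : ℕ) ≠ 0 := fun h => hp (Fin.ext h)
      exact ⟨hp, r, j, h1, h2, by omega, h4⟩
    · rintro ⟨hp, r, j, h1, h2, h3, h4⟩
      have hp' : (p : ℕ) ≠ 0 := fun h => hp (Fin.ext h)
      have := Finset.le_sup (f := List.length) (hX c j)
      exact ⟨r, by omega, h1, j, h2, by omega, h4⟩
  have hall : ∀ t, CompP fun c p => p ≠ 0 ∧ (List.ofFn (o c)).flatten[(p : ℕ) - 1]? = t := by
    rintro (_ | b)
    · refine (compP_default.not.and (CompP.exists_mem Finset.univ hsome).not).congr fun c p => ?_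
      refine and_congr_right fun hp => ?_
      rw [Option.eq_none_iff_forall_ne_some]
      simp [hp]
    · exact hsome b
  exact Comp.congr (hall t) fun c p => by
    rw [oneHot_eq]
    exact indicator_congr Iff.rfl

end Output

end HardAttention

theorem mainTheorem6 {A : Type*} {B : Type*} [Finite A] [Finite B] (f : List A → List B)
    (hf : HardAttention.UHATComputable f) : HardAttention.AHATComputable f := by
  obtain ⟨ι, _, T, hT⟩ := hf
  have hlen : ∀ w, (f w).length ≤ T.k * w.length := by
    intro w
    rw [← hT, HardAttention.UHAT.transduce, List.length_flatten, List.map_ofFn, List.sum_ofFn]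
    refine (Finset.sum_le_card_nsmul _ _ T.k fun i _ => T.out_length_le _).trans ?_
    simp [mul_comm]
  let U : (c : HardAttention.Ctx A (T.k * ·)) → Fin c.word.length → ι → ℝ := fun c => T.run c.word
  have hword : HardAttention.FinComp (HardAttention.pad
      fun (c : HardAttention.Ctx A (T.k * ·)) i => T.embed (c.word.get i)) :=
    (HardAttention.finComp_word.map (Option.map T.embed)).congr fun c p =>
      (HardAttention.pad_map _ _ c p).symm
  have hU : HardAttention.FinComp (HardAttention.pad U) :=
    HardAttention.finComp_layers T.layers hword
  have hflat : ∀ c, (List.ofFn fun p => (HardAttention.pad U c p).elim [] T.out).flatten =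
      f c.word := fun c => (HardAttention.flatten_ofFn_pad U T.out c).trans (hT c.word)
  have hout := HardAttention.comp_oneHot_flatten (hU.map fun x => x.elim [] T.out)
    (fun c => by rw [HardAttention.pad_zero]; rfl)
    (fun c => by rw [hflat]; exact (hlen _).trans_lt c.bound_lt)
  obtain ⟨ι', inst, T', hT'⟩ := HardAttention.exists_aHAT hout fun t c p => by
    rw [HardAttention.oneHot_eq]; split_ifs <;> simp
  refine ⟨ι', inst, T', (T.k * ·), fun a b h => Nat.mul_le_mul_left _ h, fun w => ⟨hlen w, ?_⟩⟩
  intro n hn hq p t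
  have := hT' ⟨w, n, hn, hq⟩ p t
  rwa [hflat] at this
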